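/- Let $d_A,d_B\ge 1$, $d=\min\{d_A,d_B\}$, and let $|\psi\rangle\in\mathbb C^{d_A}\otimes\mathbb C^{d_B}$ be a unit vector, with $\psi=|\psi\rangle\langle\psi|$. Let $|\xi_\psi\rangle=(\alpha_1,\dots,\alpha_d)$, $\alpha_i\ge 0$, be the vector of its Schmidt coefficients, i.e. $|\psi\rangle=\sum_{i=1}^d\alpha_i\,|e_i\rangle\otimes|f_i\rangle$ for some orthonormal systems $(e_i)$ in $\mathbb C^{d_A}$ and $(f_i)$ in $\mathbb C^{d_B}$ (such a decomposition exists). Notation. On Hermitian matrices put $\langle X,Y\rangle=\operatorname{Tr}(X^\dagger Y)$, and let $\preceq$ be the positive semidefinite order. Let $\mathsf{SEP}$ be the convex hull of the projectors onto normalised product vectors $|\phi\rangle\otimes|\eta\rangle$, and let $\mathsf{SEP}^*$ be its dual cone $\{X=X^\dagger:\langle X,\sigma\rangle\ge 0\ \forall \sigma\in\mathsf{SEP}\}$. For real $t\ge 0$ set $$T^{(t)}_{\mathsf{SEP}}(\rho)=\max\{\langle\rho,W\rangle : -\mathbb 1\preceq W\preceq t\,\mathbb 1,\ -W\in\mathsf{SEP}^*\}.$$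 For an integer $m\ge 1$ let $|\Psi_m\rangle=\frac{1}{\sqrt m}\sum_{i=1}^m|ii\rangle\in\mathbb C^m\otimes\mathbb C^m$, $\Psi_m=|\Psi_m\rangle\langle\Psi_m|$, and $$F_{\mathrm{SEPP}}(\rho,m)=\sup_\Lambda\,\langle\Lambda(\rho),\Psi_m\rangle,$$ where $\Lambda$ runs over the completely positive trace-preserving maps from operators on $\mathbb C^{d_A}\otimes\mathbb C^{d_B}$ to operators on $\mathbb C^m\otimes\mathbb C^m$ that map every separable state to a separable state. For real $m\ge 1$ and $x\in\mathbb C^d$ let $$\|x\|_{[m]}=\min_{x=y+z}\ \|y\|_{\ell_1}+\sqrt m\,\|z\|_{\ell_2}.$$ Theorem. For every real $m\ge 1$, $$T^{(m-1)}_{\mathsf{SEP}}(\psi)=\big\||\xi_\psi\rangle\big\|_{[m]}^2-1,$$ and for every integer $m\ge 1$, $$F_{\mathrm{SEPP}}(\psi,m)=\frac1m\,\big\||\xi_\psi\rangle\big\|_{[m]}^2 .$$ -/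

import Mathlib

noncomputable section

namespace Distill

open scoped ComplexOrder

variable {n k a b a' b' ι : Type*} [Fintype n] [DecidableEq n] [Fintype k] [DecidableEq k]
  [Fintype a] [DecidableEq a] [Fintype b] [DecidableEq b]
  [Fintype a'] [DecidableEq a'] [Fintype b'] [DecidableEq b'] [Fintype ι]

/-- Hilbert–Schmidt inner product `Tr (X† Y)`; it is a real number when `X` and `Y` are
Hermitian, the only case in which it is used. -/
def hsInner (X Y : Matrix n n ℂ) : ℝ := (X.conjTranspose * Y).trace.re

/-- The rank-one operator `|x⟩⟨x|`. -/
def ketbra (x : EuclideanSpace ℂ n) : Matrix n n ℂ := Matrix.of fun i j => x i * star (x j)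

/-- The product vector `|φ⟩ ⊗ |η⟩`, with `ℂ^a ⊗ ℂ^b` realised as `ℂ^(a × b)`. -/
def prodVec (φ : EuclideanSpace ℂ a) (η : EuclideanSpace ℂ b) : EuclideanSpace ℂ (a × b) :=
  WithLp.toLp 2 fun p => φ p.1 * η p.2

/-- Separable states: the convex hull of the projectors onto normalised product vectors. -/
def SEP (a b : Type*) [Fintype a] [Fintype b] : Set (Matrix (a × b) (a × b) ℂ) :=
  convexHull ℝ {X | ∃ (φ : EuclideanSpace ℂ a) (η : EuclideanSpace ℂ b),
    ‖φ‖ = 1 ∧ ‖η‖ = 1 ∧ X = ketbra (prodVec φ η)}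

/-- The dual cone of a set, inside the real space of Hermitian matrices. -/
def dualCone (S : Set (Matrix n n ℂ)) : Set (Matrix n n ℂ) :=
  {X | X.IsHermitian ∧ ∀ Q ∈ S, 0 ≤ hsInner X Q}

/-- The values `⟨ρ, W⟩` over the feasible `W`: `-1 ≼ W ≼ t 1` and `W ∈ -S*`. -/
def monotoneValues (S : Set (Matrix n n ℂ)) (t : ℝ) (ρ : Matrix n n ℂ) : Set ℝ :=
  {r | ∃ W : Matrix n n ℂ, (W + 1).PosSemidef ∧ (t • (1 : Matrix n n ℂ) - W).PosSemidef ∧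
    -W ∈ dualCone S ∧ r = hsInner ρ W}

/-- The monotone `T^{(t)}_S(ρ)`. -/
def monotone (S : Set (Matrix n n ℂ)) (t : ℝ) (ρ : Matrix n n ℂ) : ℝ :=
  sSup (monotoneValues S t ρ)

/-- The map `id_r ⊗ Λ`, acting blockwise. -/
def ampliation (r : ℕ) (Λ : Matrix n n ℂ →ₗ[ℂ] Matrix k k ℂ)
    (X : Matrix (Fin r × n) (Fin r × n) ℂ) : Matrix (Fin r × k) (Fin r × k) ℂ :=
  Matrix.of fun p q => Λ (Matrix.of fun i j => X (p.1, i) (q.1, j)) p.2 q.2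

/-- Completely positive trace-preserving maps. -/
structure IsCPTP (Λ : Matrix n n ℂ →ₗ[ℂ] Matrix k k ℂ) : Prop where
  completelyPositive : ∀ (r : ℕ) (X : Matrix (Fin r × n) (Fin r × n) ℂ),
    X.PosSemidef → (ampliation r Λ X).PosSemidef
  tracePreserving : ∀ X : Matrix n n ℂ, (Λ X).trace = X.trace

/-- Separability-preserving operations `AB → A'B'`. -/
def SEPP (a b a' b' : Type*) [Fintype a] [Fintype b] [Fintype a'] [Fintype b'] :
    Set (Matrix (a × b) (a × b) ℂ →ₗ[ℂ] Matrix (a' × b') (a' × b') ℂ) :=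
  {Λ | IsCPTP Λ ∧ ∀ σ ∈ SEP a b, Λ σ ∈ SEP a' b'}

/-- The maximally entangled vector `∑ i, |ii⟩ / √m`. -/
def maxEntangled (m : ℕ) : EuclideanSpace ℂ (Fin m × Fin m) :=
  WithLp.toLp 2 fun p => if p.1 = p.2 then ((1 / Real.sqrt m : ℝ) : ℂ) else 0

/-- The overlaps `⟨Λ(ρ), Ψ_m⟩` over the operations `Λ` of a class `O`. -/
def fidelityValues {m : ℕ}
    (O : Set (Matrix (a × b) (a × b) ℂ →ₗ[ℂ] Matrix (Fin m × Fin m) (Fin m × Fin m) ℂ))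
    (ρ : Matrix (a × b) (a × b) ℂ) : Set ℝ :=
  {r | ∃ Λ ∈ O, r = hsInner (Λ ρ) (ketbra (maxEntangled m))}

/-- The fidelity of distillation `F_SEPP(ρ, m)`. -/
def fidelitySEPP (ρ : Matrix (a × b) (a × b) ℂ) (m : ℕ) : ℝ :=
  sSup (fidelityValues (SEPP a b (Fin m) (Fin m)) ρ)

/-- The `m`-distillation norm: the least value of `‖y‖₁ + √m ‖z‖₂` over `x = y + z`.
The set is nonempty, bounded below by `0`, and by compactness its infimum is a minimum. -/
def distNorm (m : ℝ) (x : EuclideanSpace ℂ ι) : ℝ :=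
  sInf {r | ∃ y z : EuclideanSpace ℂ ι, x = y + z ∧ r = ∑ i, ‖y i‖ + Real.sqrt m * ‖z‖}

/-- `ξ` is a vector of Schmidt coefficients of `ψ`: `ψ = ∑ i, ξ i |e i⟩ ⊗ |f i⟩` with `ξ i ≥ 0`
and orthonormal systems `e`, `f` of length `d = min d_A d_B`. -/
def IsSchmidtVector {dA dB : ℕ} (ψ : EuclideanSpace ℂ (Fin dA × Fin dB))
    (ξ : Fin (min dA dB) → ℝ) : Prop :=
  (∀ i, 0 ≤ ξ i) ∧
  ∃ (e : Fin (min dA dB) → EuclideanSpace ℂ (Fin dA))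
    (f : Fin (min dA dB) → EuclideanSpace ℂ (Fin dB)),
    Orthonormal ℂ e ∧ Orthonormal ℂ f ∧ ψ = ∑ i, (ξ i : ℂ) • prodVec (e i) (f i)

/-- A real vector seen as a vector of complex Euclidean space. -/
def toComplexVec (ξ : ι → ℝ) : EuclideanSpace ℂ ι := WithLp.toLp 2 fun i => (ξ i : ℂ)

end Distill

end

noncomputable section

namespace Distill

open scoped ComplexOrder InnerProductSpace
open Matrix

section Basic

lemma ketbra_eq_vecMulVec {n : Type*} (x : EuclideanSpace ℂ n) :
    ketbra x = vecMulVec x.ofLp (star x.ofLp) := by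
  ext i j
  simp [ketbra, vecMulVec_apply]

variable {n a b ι : Type*} [Fintype n] [Fintype a] [Fintype b] [Fintype ι]

lemma hsInner_comm (X Y : Matrix n n ℂ) : hsInner X Y = hsInner Y X := by
  unfold hsInner
  rw [← conjTranspose_conjTranspose Y, ← conjTranspose_mul, trace_conjTranspose]
  simp

lemma hsInner_add_right (X Y Z : Matrix n n ℂ) :
    hsInner X (Y + Z) = hsInner X Y + hsInner X Z := by
  simp [hsInner, mul_add]

lemma hsInner_sub_right (X Y Z : Matrix n n ℂ) :
    hsInner X (Y - Z) = hsInner X Y - hsInner X Z := by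
  simp [hsInner, mul_sub]

lemma hsInner_smul_right (c : ℝ) (X Y : Matrix n n ℂ) :
    hsInner X (c • Y) = c * hsInner X Y := by
  simp [hsInner]

lemma hsInner_ketbra_left (x : EuclideanSpace ℂ n) (Y : Matrix n n ℂ) :
    hsInner (ketbra x) Y = (star x.ofLp ⬝ᵥ Y *ᵥ x.ofLp).re := by
  unfold hsInner
  congr 1
  simp only [trace, diag_apply, mul_apply, conjTranspose_apply, ketbra, of_apply, dotProduct,
    mulVec, Finset.mul_sum, Pi.star_apply, star_mul', star_star]
  rw [Finset.sum_comm]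
  refine Finset.sum_congr rfl fun i _ => Finset.sum_congr rfl fun j _ => ?_
  ring

lemma posSemidef_ketbra (x : EuclideanSpace ℂ n) : (ketbra x).PosSemidef := by
  rw [ketbra_eq_vecMulVec]
  exact posSemidef_vecMulVec_self_star _

lemma hsInner_ketbra_ketbra (x y : EuclideanSpace ℂ n) :
    hsInner (ketbra x) (ketbra y) = ‖⟪y, x⟫_ℂ‖ ^ 2 := by
  rw [hsInner_ketbra_left, ketbra_eq_vecMulVec, vecMulVec_mulVec,
    EuclideanSpace.inner_eq_star_dotProduct, ← Complex.normSq_eq_norm_sq]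
  have : star x.ofLp ⬝ᵥ y.ofLp = star (x.ofLp ⬝ᵥ star y.ofLp) := by
    rw [star_dotProduct, dotProduct_comm]
  simp only [dotProduct_smul, this, dotProduct_comm (star y.ofLp)]
  simp [Complex.normSq_apply]

lemma hsInner_ketbra_one [DecidableEq n] (x : EuclideanSpace ℂ n) :
    hsInner (ketbra x) 1 = ‖x‖ ^ 2 := by
  rw [hsInner_ketbra_left, one_mulVec, dotProduct_comm,
    ← EuclideanSpace.inner_eq_star_dotProduct, inner_self_eq_norm_sq_to_K]
  norm_cast

lemma hsInner_ketbra_nonneg {Y : Matrix n n ℂ} (hY : Y.PosSemidef) (x : EuclideanSpace ℂ n) :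
    0 ≤ hsInner (ketbra x) Y := by
  rw [hsInner_ketbra_left]
  exact (Complex.nonneg_iff.1 (hY.dotProduct_mulVec_nonneg _)).1

/-- A positive semidefinite form is the square of a Hilbert seminorm. -/
lemma exists_hsInner_ketbra_eq_norm_sq [DecidableEq n] {Y : Matrix n n ℂ} (hY : Y.PosSemidef) :
    ∃ C : EuclideanSpace ℂ n →ₗ[ℂ] EuclideanSpace ℂ n,
      ∀ x, hsInner (ketbra x) Y = ‖C x‖ ^ 2 := by
  obtain ⟨C, rfl⟩ : ∃ C : Matrix n n ℂ, Y = Cᴴ * C := by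
    open scoped MatrixOrder in
    exact CStarAlgebra.nonneg_iff_eq_star_mul_self.1 hY.nonneg
  refine ⟨toEuclideanLin C, fun x => ?_⟩
  rw [hsInner_ketbra_left, ← mulVec_mulVec, dotProduct_mulVec, ← star_mulVec, dotProduct_comm]
  have := inner_self_eq_norm_sq_to_K (𝕜 := ℂ) (toEuclideanLin C x)
  rw [EuclideanSpace.inner_eq_star_dotProduct] at this
  simp only [ofLp_toLpLin, toLin'_apply] at this
  rw [this]
  norm_cast

/-- A complex matrix with nonnegative quadratic form is positive semidefinite. -/
lemma posSemidef_of_dotProduct_nonneg [DecidableEq n] {M : Matrix n n ℂ}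
    (h : ∀ x : n → ℂ, 0 ≤ star x ⬝ᵥ M *ᵥ x) : M.PosSemidef := by
  refine posSemidef_iff_dotProduct_mulVec.2 ⟨?_, h⟩
  rw [← isSymmetric_toEuclideanLin_iff, LinearMap.isSymmetric_iff_inner_map_self_real]
  intro v
  have : ⟪toEuclideanLin M v, v⟫_ℂ = star (star v.ofLp ⬝ᵥ M *ᵥ v.ofLp) := by
    rw [EuclideanSpace.inner_eq_star_dotProduct, star_dotProduct, star_star, dotProduct_comm]
    simp
  rw [this]
  have h2 := Complex.conj_eq_iff_im.2 (Complex.nonneg_iff.1 (h v.ofLp)).2.symm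
  simp only [starRingEnd_apply] at *
  rw [h2, h2]

lemma inner_prodVec (φ φ' : EuclideanSpace ℂ a) (η η' : EuclideanSpace ℂ b) :
    ⟪prodVec φ η, prodVec φ' η'⟫_ℂ = ⟪φ, φ'⟫_ℂ * ⟪η, η'⟫_ℂ := by
  simp only [PiLp.inner_apply, prodVec, Fintype.sum_prod_type, Finset.sum_mul_sum,
    RCLike.inner_apply, map_mul]
  refine Finset.sum_congr rfl fun i _ => Finset.sum_congr rfl fun j _ => ?_
  ring

lemma norm_prodVec (φ : EuclideanSpace ℂ a) (η : EuclideanSpace ℂ b) :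
    ‖prodVec φ η‖ = ‖φ‖ * ‖η‖ := by
  have h := inner_prodVec φ φ η η
  simp only [inner_self_eq_norm_sq_to_K] at h
  have h' : ‖prodVec φ η‖ ^ 2 = (‖φ‖ * ‖η‖) ^ 2 := by
    rw [mul_pow]; exact_mod_cast h
  exact (sq_eq_sq₀ (norm_nonneg _) (by positivity)).1 h'

lemma orthonormal_prodVec {ι : Type*} {e : ι → EuclideanSpace ℂ a} {f : ι → EuclideanSpace ℂ b}
    (he : Orthonormal ℂ e) (hf : Orthonormal ℂ f) :
    Orthonormal ℂ fun i => prodVec (e i) (f i) := by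
  refine ⟨fun i => by simp [norm_prodVec, he.1 i, hf.1 i], fun i j hij => ?_⟩
  simp [inner_prodVec, he.2 hij]

lemma norm_sq_sum_smul_of_orthonormal {E : Type*} [NormedAddCommGroup E] [InnerProductSpace ℂ E]
    {v : ι → E} (hv : Orthonormal ℂ v) (x : ι → ℂ) :
    ‖∑ i, x i • v i‖ ^ 2 = ∑ i, ‖x i‖ ^ 2 := by
  have h := hv.inner_sum x x Finset.univ
  rw [inner_self_eq_norm_sq_to_K] at h
  have h2 : ∀ i, (starRingEnd ℂ) (x i) * x i = ((‖x i‖ ^ 2 : ℝ) : ℂ) := fun i => by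
    rw [Complex.conj_mul']; norm_cast
  simp only [h2, Complex.coe_algebraMap] at h
  exact_mod_cast h

/-- The overlap of a normalised product vector with a vector in Schmidt form is at most the
largest coefficient. -/
lemma norm_inner_prodVec_schmidt_le {e : ι → EuclideanSpace ℂ a} {f : ι → EuclideanSpace ℂ b}
    (he : Orthonormal ℂ e) (hf : Orthonormal ℂ f) {w : ι → ℂ} {c : ℝ} (hc : 0 ≤ c)
    (hw : ∀ i, ‖w i‖ ≤ c) {φ : EuclideanSpace ℂ a} {η : EuclideanSpace ℂ b}
    (hφ : ‖φ‖ = 1) (hη : ‖η‖ = 1) :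
    ‖⟪∑ i, w i • prodVec (e i) (f i), prodVec φ η⟫_ℂ‖ ≤ c := by
  have hE := he.sum_inner_products_le φ (s := Finset.univ)
  have hF := hf.sum_inner_products_le η (s := Finset.univ)
  rw [hφ] at hE
  rw [hη] at hF
  calc ‖⟪∑ i, w i • prodVec (e i) (f i), prodVec φ η⟫_ℂ‖
      ≤ ∑ i, ‖w i‖ * (‖⟪e i, φ⟫_ℂ‖ * ‖⟪f i, η⟫_ℂ‖) := by
        rw [sum_inner]
        refine (norm_sum_le _ _).trans (Finset.sum_le_sum fun i _ => ?_)
        rw [inner_smul_left, inner_prodVec]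
        simp
    _ ≤ ∑ i, c * ((‖⟪e i, φ⟫_ℂ‖ ^ 2 + ‖⟪f i, η⟫_ℂ‖ ^ 2) / 2) := by
        refine Finset.sum_le_sum fun i _ => ?_
        refine mul_le_mul (hw i) ?_ (by positivity) hc
        nlinarith [sq_nonneg (‖⟪e i, φ⟫_ℂ‖ - ‖⟪f i, η⟫_ℂ‖)]
    _ = c * ((∑ i, ‖⟪e i, φ⟫_ℂ‖ ^ 2 + ∑ i, ‖⟪f i, η⟫_ℂ‖ ^ 2) / 2) := by
        rw [← Finset.mul_sum, ← Finset.sum_div, Finset.sum_add_distrib]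
    _ ≤ c := by nlinarith

lemma ketbra_prodVec_mem_SEP {φ : EuclideanSpace ℂ a} {η : EuclideanSpace ℂ b}
    (hφ : ‖φ‖ = 1) (hη : ‖η‖ = 1) : ketbra (prodVec φ η) ∈ SEP a b :=
  subset_convexHull ℝ _ ⟨φ, η, hφ, hη, rfl⟩

lemma convex_SEP : Convex ℝ (SEP a b) := convex_convexHull ℝ _

/-- A linear upper bound on separable states may be checked on product states. -/
lemma hsInner_le_of_mem_SEP {Y : Matrix (a × b) (a × b) ℂ} {c : ℝ}
    (h : ∀ (φ : EuclideanSpace ℂ a) (η : EuclideanSpace ℂ b), ‖φ‖ = 1 → ‖η‖ = 1 →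
      hsInner (ketbra (prodVec φ η)) Y ≤ c)
    {σ : Matrix (a × b) (a × b) ℂ} (hσ : σ ∈ SEP a b) : hsInner Y σ ≤ c := by
  have hconv : Convex ℝ {X : Matrix (a × b) (a × b) ℂ | hsInner Y X ≤ c} := by
    intro X hX Z hZ s t hs ht hst
    simp only [Set.mem_ofPred_eq, hsInner_add_right, hsInner_smul_right] at *
    calc s * hsInner Y X + t * hsInner Y Z ≤ s * c + t * c := by gcongr
      _ = c := by rw [← add_mul, hst, one_mul]
  refine convexHull_min ?_ hconv hσ
  rintro X ⟨φ, η, hφ, hη, rfl⟩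
  simpa [hsInner_comm Y] using h φ η hφ hη

lemma trace_ketbra (x : EuclideanSpace ℂ n) : (ketbra x).trace = ((‖x‖ ^ 2 : ℝ) : ℂ) := by
  have := inner_self_eq_norm_sq_to_K (𝕜 := ℂ) x
  rw [EuclideanSpace.inner_eq_star_dotProduct] at this
  rw [ketbra_eq_vecMulVec, trace_vecMulVec, this]
  norm_cast

lemma trace_of_mem_SEP {σ : Matrix (a × b) (a × b) ℂ} (hσ : σ ∈ SEP a b) : σ.trace = 1 := by
  have hconv : Convex ℝ {X : Matrix (a × b) (a × b) ℂ | X.trace = 1} := by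
    intro X hX Z hZ s t _ _ hst
    simp only [Set.mem_ofPred_eq, trace_add, trace_smul] at *
    rw [hX, hZ, ← add_smul, hst, one_smul]
  refine convexHull_min ?_ hconv hσ
  rintro X ⟨φ, η, hφ, hη, rfl⟩
  simp [trace_ketbra, norm_prodVec, hφ, hη]

end Basic

section Norm

variable {a b ι : Type*} [Fintype a] [Fintype b] [Fintype ι]

lemma distNorm_le_of_eq_add {m : ℝ} {x y z : EuclideanSpace ℂ ι} (h : x = y + z) :
    distNorm m x ≤ ∑ i, ‖y i‖ + Real.sqrt m * ‖z‖ := by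
  refine csInf_le ⟨0, ?_⟩ ⟨y, z, h, rfl⟩
  rintro r ⟨y, z, -, rfl⟩
  positivity

lemma distNorm_nonneg (m : ℝ) (x : EuclideanSpace ℂ ι) : 0 ≤ distNorm m x := by
  refine Real.sInf_nonneg ?_
  rintro r ⟨y, z, -, rfl⟩
  positivity

/-- A witness with `0 ≼ X ≼ m` and overlap at most one with all product states has overlap at most
`‖ξ‖_[m] ^ 2` with a vector of Schmidt coefficients `ξ`. -/
lemma hsInner_ketbra_le_distNorm_sq [DecidableEq a] [DecidableEq b]
    {e : ι → EuclideanSpace ℂ a} {f : ι → EuclideanSpace ℂ b}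
    (he : Orthonormal ℂ e) (hf : Orthonormal ℂ f) (ξ : EuclideanSpace ℂ ι) {m : ℝ} (hm : 0 ≤ m)
    {X : Matrix (a × b) (a × b) ℂ} (hX : X.PosSemidef)
    (hXm : (m • (1 : Matrix (a × b) (a × b) ℂ) - X).PosSemidef)
    (hprod : ∀ (φ : EuclideanSpace ℂ a) (η : EuclideanSpace ℂ b), ‖φ‖ = 1 → ‖η‖ = 1 →
      hsInner (ketbra (prodVec φ η)) X ≤ 1) :
    hsInner (ketbra (∑ i, ξ i • prodVec (e i) (f i))) X ≤ distNorm m ξ ^ 2 := by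
  obtain ⟨C, hC⟩ := exists_hsInner_ketbra_eq_norm_sq hX
  have hCm : ∀ x, ‖C x‖ ≤ Real.sqrt m * ‖x‖ := by
    intro x
    have h := hsInner_ketbra_nonneg hXm x
    rw [hsInner_sub_right, hsInner_smul_right, hsInner_ketbra_one, hC] at h
    refine le_of_sq_le_sq ?_ (by positivity)
    rw [mul_pow, Real.sq_sqrt hm]
    linarith
  have hCp : ∀ i, ‖C (prodVec (e i) (f i))‖ ≤ 1 := by
    intro i
    have h := hprod _ _ (he.1 i) (hf.1 i)
    rw [hC] at h
    exact (sq_le_one_iff₀ (norm_nonneg _)).1 h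
  rw [hC]
  refine pow_le_pow_left₀ (norm_nonneg _) ?_ 2
  refine le_csInf ⟨_, ξ, 0, by simp, rfl⟩ ?_
  rintro r ⟨y, z, rfl, rfl⟩
  have hz : ‖∑ i, z i • prodVec (e i) (f i)‖ = ‖z‖ := by
    refine (sq_eq_sq₀ (norm_nonneg _) (norm_nonneg _)).1 ?_
    rw [norm_sq_sum_smul_of_orthonormal (orthonormal_prodVec he hf) z, EuclideanSpace.norm_sq_eq]
  have hsplit : ∑ i, (y + z) i • prodVec (e i) (f i)
      = ∑ i, y i • prodVec (e i) (f i) + ∑ i, z i • prodVec (e i) (f i) := by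
    simp [add_smul, Finset.sum_add_distrib]
  rw [hsplit, map_add]
  refine (norm_add_le _ _).trans (add_le_add ?_ ?_)
  · rw [map_sum]
    refine (norm_sum_le _ _).trans (Finset.sum_le_sum fun i _ => ?_)
    rw [map_smul, norm_smul]
    exact mul_le_of_le_one_right (norm_nonneg _) (hCp i)
  · simpa [hz] using hCm (∑ i, z i • prodVec (e i) (f i))

/-- The threshold `λ` at which truncating `ξ` gives a vector of squared length `m λ ^ 2`. -/
lemma exists_truncation {ξ : ι → ℝ} (hξ : ∀ i, 0 ≤ ξ i) (hsum : ∑ i, ξ i ^ 2 = 1) {m : ℝ}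
    (hm : 1 ≤ m) (hcard : m ≤ (Finset.univ.filter fun i => ξ i ≠ 0).card) :
    ∃ l : ℝ, 0 < l ∧ ∑ i, (min (ξ i) l) ^ 2 = m * l ^ 2 := by
  obtain ⟨j, hj⟩ : (Finset.univ.filter fun i => ξ i ≠ 0).Nonempty := by
    rw [← Finset.card_pos]
    have : (0 : ℝ) < (Finset.univ.filter fun i => ξ i ≠ 0).card := by linarith
    exact_mod_cast this
  obtain ⟨k, hk, hmin⟩ := Finset.exists_min_image (Finset.univ.filter fun i => ξ i ≠ 0) ξ ⟨j, hj⟩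
  have hk0 : 0 < ξ k := lt_of_le_of_ne (hξ k) (Ne.symm (Finset.mem_filter.1 hk).2)
  have hle : ∀ i, ξ i ≤ 1 := fun i => by
    have : ξ i ^ 2 ≤ 1 := hsum ▸ Finset.single_le_sum (f := fun i => ξ i ^ 2)
      (fun i _ => sq_nonneg (ξ i)) (Finset.mem_univ i)
    exact (sq_le_one_iff₀ (hξ i)).1 this
  have hcont : Continuous fun l : ℝ => m * l ^ 2 - ∑ i, (min (ξ i) l) ^ 2 := by fun_prop
  have h1 : 0 ≤ m * (1 : ℝ) ^ 2 - ∑ i, (min (ξ i) 1) ^ 2 := by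
    simp only [min_eq_left (hle _), hsum]
    linarith
  have h0 : m * (ξ k) ^ 2 - ∑ i, (min (ξ i) (ξ k)) ^ 2 ≤ 0 := by
    have : ((Finset.univ.filter fun i => ξ i ≠ 0).card : ℝ) * ξ k ^ 2
        ≤ ∑ i, (min (ξ i) (ξ k)) ^ 2 := by
      rw [← nsmul_eq_mul, ← Finset.sum_const]
      refine (Finset.sum_le_sum fun i hi => ?_).trans
        (Finset.sum_le_sum_of_subset_of_nonneg (Finset.filter_subset _ _)
          fun i _ _ => sq_nonneg _)
      rw [min_eq_right (hmin i hi)]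
    nlinarith [sq_nonneg (ξ k)]
  obtain ⟨l, hl, hl0⟩ := intermediate_value_Icc (hle k) hcont.continuousOn ⟨h0, h1⟩
  exact ⟨l, hk0.trans_le hl.1, (sub_eq_zero.1 hl0).symm⟩

/-- The dual witness of the distillation norm on a normalised nonnegative vector. -/
lemma exists_dual_witness {ξ : ι → ℝ} (hξ : ∀ i, 0 ≤ ξ i) (hsum : ∑ i, ξ i ^ 2 = 1) {m : ℝ}
    (hm : 1 ≤ m) :
    ∃ w : ι → ℝ, (∀ i, 0 ≤ w i) ∧ (∀ i, w i ≤ 1) ∧ ∑ i, w i ^ 2 ≤ m ∧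
      distNorm m (toComplexVec ξ) ≤ ∑ i, w i * ξ i := by
  classical
  rcases le_or_gt m (Finset.univ.filter fun i => ξ i ≠ 0).card with hcard | hcard
  · obtain ⟨l, hl, hleq⟩ := exists_truncation hξ hsum hm hcard
    have hz0 : ∀ i, 0 ≤ min (ξ i) l := fun i => le_min (hξ i) hl.le
    refine ⟨fun i => min (ξ i) l / l, fun i => div_nonneg (hz0 i) hl.le,
      fun i => (div_le_one hl).2 (min_le_right _ _), ?_, ?_⟩
    · simp only [div_pow, ← Finset.sum_div, hleq]
      rw [mul_div_assoc, div_self (by positivity), mul_one]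
    · have hzn : ‖toComplexVec fun i => min (ξ i) l‖ = Real.sqrt m * l := by
        refine (sq_eq_sq₀ (norm_nonneg _) (by positivity)).1 ?_
        rw [EuclideanSpace.norm_sq_eq, mul_pow, Real.sq_sqrt (by linarith), ← hleq]
        simp [toComplexVec]
      refine (distNorm_le_of_eq_add (y := toComplexVec fun i => ξ i - min (ξ i) l)
        (z := toComplexVec fun i => min (ξ i) l) ?_).trans (le_of_eq ?_)
      · ext i; simp [toComplexVec]
      · rw [hzn, ← mul_assoc, Real.mul_self_sqrt (by linarith)]
        have h1 : m * l = ∑ i, min (ξ i) l / l * min (ξ i) l := by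
          have : m * l = (∑ i, min (ξ i) l ^ 2) / l := by rw [hleq]; field_simp
          rw [this, Finset.sum_div]
          exact Finset.sum_congr rfl fun i _ => by ring
        rw [h1, ← Finset.sum_add_distrib]
        refine Finset.sum_congr rfl fun i _ => ?_
        have h2 : ‖(toComplexVec fun i => ξ i - min (ξ i) l) i‖ = ξ i - min (ξ i) l := by
          simp only [toComplexVec, Complex.norm_real, Real.norm_eq_abs]
          exact abs_of_nonneg (sub_nonneg.2 (min_le_left _ _))
        rw [h2]
        rcases le_total (ξ i) l with h | h
        · simp [min_eq_left h]
        · simp [min_eq_right h, hl.ne']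
  · refine ⟨fun i => if ξ i ≠ 0 then 1 else 0, fun i => ?_, fun i => ?_, ?_, ?_⟩
    · dsimp only; split_ifs <;> simp
    · dsimp only; split_ifs <;> simp
    · refine le_trans (le_of_eq ?_) hcard.le
      simp [Finset.sum_ite]
    · refine (distNorm_le_of_eq_add (y := toComplexVec ξ) (z := 0) (by simp)).trans (le_of_eq ?_)
      simp only [norm_zero, mul_zero, add_zero]
      refine Finset.sum_congr rfl fun i _ => ?_
      by_cases h : ξ i = 0 <;> simp [toComplexVec, h, abs_of_nonneg (hξ i)]

/-- The rank-one witness attaining the distillation norm. -/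
lemma exists_optimal_vector {e : ι → EuclideanSpace ℂ a} {f : ι → EuclideanSpace ℂ b}
    (he : Orthonormal ℂ e) (hf : Orthonormal ℂ f) {ξ : ι → ℝ} (hξ : ∀ i, 0 ≤ ξ i)
    (hsum : ∑ i, ξ i ^ 2 = 1) {m : ℝ} (hm : 1 ≤ m) :
    ∃ v : EuclideanSpace ℂ (a × b), ‖v‖ ^ 2 ≤ m ∧
      (∀ (φ : EuclideanSpace ℂ a) (η : EuclideanSpace ℂ b), ‖φ‖ = 1 → ‖η‖ = 1 →
        hsInner (ketbra (prodVec φ η)) (ketbra v) ≤ 1) ∧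
      distNorm m (toComplexVec ξ) ^ 2 ≤
        hsInner (ketbra (∑ i, (ξ i : ℂ) • prodVec (e i) (f i))) (ketbra v) := by
  obtain ⟨w, hw0, hw1, hwm, hw⟩ := exists_dual_witness hξ hsum hm
  have ho := orthonormal_prodVec he hf
  refine ⟨∑ i, (w i : ℂ) • prodVec (e i) (f i), ?_, ?_, ?_⟩
  · rw [norm_sq_sum_smul_of_orthonormal ho]
    simpa using hwm
  · intro φ η hφ hη
    rw [hsInner_ketbra_ketbra]
    refine (sq_le_one_iff₀ (norm_nonneg _)).2 (norm_inner_prodVec_schmidt_le he hf zero_le_one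
      (fun i => ?_) hφ hη)
    simpa [abs_of_nonneg (hw0 i)] using hw1 i
  · rw [hsInner_ketbra_ketbra, ho.inner_sum]
    refine pow_le_pow_left₀ (distNorm_nonneg _ _) (hw.trans (le_trans (le_abs_self _) ?_)) 2
    rw [← Real.norm_eq_abs, ← Complex.norm_real]
    simp

lemma posSemidef_smul_one_sub_ketbra {n : Type*} [Fintype n] [DecidableEq n] {m : ℝ}
    {v : EuclideanSpace ℂ n} (hv : ‖v‖ ^ 2 ≤ m) :
    (m • (1 : Matrix n n ℂ) - ketbra v).PosSemidef := by
  have hH : (m • (1 : Matrix n n ℂ) - ketbra v).IsHermitian := by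
    refine IsHermitian.sub ?_ (posSemidef_ketbra v).1
    simp [IsHermitian, conjTranspose_smul]
  refine posSemidef_iff_dotProduct_mulVec.2 ⟨hH, fun x => ?_⟩
  refine Complex.nonneg_iff.2 ⟨?_, (hH.im_star_dotProduct_mulVec_self x).symm⟩
  have h := hsInner_ketbra_left (WithLp.toLp 2 x) (m • (1 : Matrix n n ℂ) - ketbra v)
  rw [hsInner_sub_right, hsInner_smul_right, hsInner_ketbra_one, hsInner_ketbra_ketbra] at h
  rw [← h, sub_nonneg]
  calc _ ≤ (‖v‖ * ‖WithLp.toLp 2 x‖) ^ 2 :=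
        pow_le_pow_left₀ (norm_nonneg _) (norm_inner_le_norm _ _) 2
    _ ≤ _ := by rw [mul_pow]; gcongr

end Norm

section Monotone

variable {a b ι : Type*} [Fintype a] [Fintype b] [Fintype ι] [DecidableEq a] [DecidableEq b]

lemma isGreatest_monotoneValues {e : ι → EuclideanSpace ℂ a} {f : ι → EuclideanSpace ℂ b}
    (he : Orthonormal ℂ e) (hf : Orthonormal ℂ f) {ξ : ι → ℝ} (hξ : ∀ i, 0 ≤ ξ i)
    {ψ : EuclideanSpace ℂ (a × b)} (hψ : ‖ψ‖ = 1)
    (hsch : ψ = ∑ i, (ξ i : ℂ) • prodVec (e i) (f i)) {m : ℝ} (hm : 1 ≤ m) :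
    IsGreatest (monotoneValues (SEP a b) (m - 1) (ketbra ψ))
      (distNorm m (toComplexVec ξ) ^ 2 - 1) := by
  have hsum : ∑ i, ξ i ^ 2 = 1 := by
    have h := norm_sq_sum_smul_of_orthonormal (orthonormal_prodVec he hf) fun i => (ξ i : ℂ)
    rw [← hsch, hψ] at h
    simpa using h.symm
  have key : ∀ X : Matrix (a × b) (a × b) ℂ, X.PosSemidef →
      (m • (1 : Matrix (a × b) (a × b) ℂ) - X).PosSemidef →
      (∀ (φ : EuclideanSpace ℂ a) (η : EuclideanSpace ℂ b), ‖φ‖ = 1 → ‖η‖ = 1 →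
        hsInner (ketbra (prodVec φ η)) X ≤ 1) →
      hsInner (ketbra ψ) X ≤ distNorm m (toComplexVec ξ) ^ 2 := fun X hX hXm hp => by
    rw [hsch]
    exact hsInner_ketbra_le_distNorm_sq he hf (toComplexVec ξ) (by linarith) hX hXm hp
  have h1 : hsInner (ketbra ψ) 1 = 1 := by rw [hsInner_ketbra_one, hψ, one_pow]
  constructor
  · obtain ⟨v, hvm, hvp, hv⟩ := exists_optimal_vector he hf hξ hsum hm
    rw [← hsch] at hv
    have hle := posSemidef_smul_one_sub_ketbra hvm
    refine ⟨ketbra v - 1, ?_, ?_, ⟨?_, fun σ hσ => ?_⟩, ?_⟩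
    · simpa using posSemidef_ketbra v
    · convert hle using 1
      rw [sub_smul, one_smul]; abel
    · rw [neg_sub]
      exact isHermitian_one.sub (posSemidef_ketbra v).1
    · have h2 := hsInner_le_of_mem_SEP hvp hσ
      have h3 : hsInner σ 1 = 1 := by
        rw [hsInner_comm]; simp [hsInner, trace_of_mem_SEP hσ]
      rw [hsInner_comm, neg_sub, hsInner_sub_right, h3, hsInner_comm]
      linarith
    · rw [hsInner_sub_right, h1, le_antisymm hv (key _ (posSemidef_ketbra v) hle hvp)]
  · rintro r ⟨W, hW1, hWm, ⟨-, hWs⟩, rfl⟩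
    have h := key (W + 1) hW1 ?_ fun φ η hφ hη => ?_
    · rw [hsInner_add_right, h1] at h
      linarith
    · convert hWm using 1
      rw [sub_smul, one_smul]; abel
    · have h2 := hWs _ (ketbra_prodVec_mem_SEP hφ hη)
      rw [hsInner_comm, ← zero_sub, hsInner_sub_right] at h2
      have h3 : hsInner (ketbra (prodVec φ η)) 0 = 0 := by simp [hsInner]
      rw [hsInner_add_right, hsInner_ketbra_one, norm_prodVec, hφ, hη]
      linarith

end Monotone

section Operations

variable {n k : Type*} [Fintype n] [Fintype k]

lemma trace_mul_nonneg_of_posSemidef [DecidableEq n] {P Q : Matrix n n ℂ} (hP : P.PosSemidef)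
    (hQ : Q.PosSemidef) : 0 ≤ (P * Q).trace := by
  obtain ⟨C, rfl⟩ : ∃ C : Matrix n n ℂ, P = Cᴴ * C := by
    open scoped MatrixOrder in
    exact CStarAlgebra.nonneg_iff_eq_star_mul_self.1 hP.nonneg
  rw [mul_assoc, trace_mul_comm]
  exact (hQ.mul_mul_conjTranspose_same C).trace_nonneg

/-- The matrix representing a linear functional through its values on rank-one operators. -/
lemma dotProduct_functional_mulVec [DecidableEq n] (g : Matrix n n ℂ →ₗ[ℂ] ℂ) (x : n → ℂ) :
    star x ⬝ᵥ (Matrix.of fun i j => g (Matrix.single j i 1)) *ᵥ x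
      = g (ketbra (WithLp.toLp 2 x)) := by
  have h : ketbra (WithLp.toLp 2 x) = ∑ i, ∑ j, (x i * star (x j)) • Matrix.single i j (1 : ℂ) := by
    conv_lhs => rw [matrix_eq_sum_single (ketbra (WithLp.toLp 2 x))]
    refine Finset.sum_congr rfl fun i _ => Finset.sum_congr rfl fun j _ => ?_
    simp [ketbra, smul_single]
  rw [h]
  simp only [map_sum, map_smul, smul_eq_mul, dotProduct, mulVec, of_apply, Pi.star_apply,
    Finset.mul_sum]
  rw [Finset.sum_comm]
  refine Finset.sum_congr rfl fun i _ => Finset.sum_congr rfl fun j _ => ?_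
  ring

lemma IsCPTP.posSemidef_map [DecidableEq n] {Λ : Matrix n n ℂ →ₗ[ℂ] Matrix k k ℂ} (hΛ : IsCPTP Λ)
    {X : Matrix n n ℂ} (hX : X.PosSemidef) : (Λ X).PosSemidef := by
  have h := hΛ.completelyPositive 1 (X.submatrix Prod.snd Prod.snd) (hX.submatrix _)
  have h2 := h.submatrix fun i : k => ((0 : Fin 1), i)
  exact h2

/-- Pulling back the projector onto a unit vector along a channel gives an effect. -/
lemma IsCPTP.exists_effect [DecidableEq n] [DecidableEq k] {Λ : Matrix n n ℂ →ₗ[ℂ] Matrix k k ℂ}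
    (hΛ : IsCPTP Λ) {u : EuclideanSpace ℂ k} (hu : ‖u‖ = 1) :
    ∃ X : Matrix n n ℂ, X.PosSemidef ∧ (1 - X).PosSemidef ∧
      ∀ x, hsInner (ketbra x) X = hsInner (Λ (ketbra x)) (ketbra u) := by
  let g : Matrix n n ℂ →ₗ[ℂ] ℂ :=
    (traceLinearMap k ℂ ℂ) ∘ₗ (LinearMap.mulRight ℂ (ketbra u)) ∘ₗ Λ
  have hg : ∀ Y, g Y = (Λ Y * ketbra u).trace := fun Y => rfl
  refine ⟨Matrix.of fun i j => g (Matrix.single j i 1), ?_, ?_, fun x => ?_⟩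
  · refine posSemidef_of_dotProduct_nonneg fun x => ?_
    rw [dotProduct_functional_mulVec, hg]
    exact trace_mul_nonneg_of_posSemidef (hΛ.posSemidef_map (posSemidef_ketbra _))
      (posSemidef_ketbra u)
  · refine posSemidef_of_dotProduct_nonneg fun x => ?_
    rw [sub_mulVec, dotProduct_sub, dotProduct_functional_mulVec, hg, one_mulVec]
    have h1 : star x ⬝ᵥ x = (Λ (ketbra (WithLp.toLp 2 x))).trace := by
      rw [hΛ.tracePreserving, ketbra_eq_vecMulVec, trace_vecMulVec, dotProduct_comm]
    have h2 : (1 - ketbra u).PosSemidef := by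
      simpa using posSemidef_smul_one_sub_ketbra (m := 1) (v := u) (by simp [hu])
    have h3 := trace_mul_nonneg_of_posSemidef
      (hΛ.posSemidef_map (posSemidef_ketbra (WithLp.toLp 2 x))) h2
    rwa [mul_sub, mul_one, trace_sub, ← h1] at h3
  · rw [hsInner_ketbra_left, dotProduct_functional_mulVec, hg, hsInner,
      (hΛ.posSemidef_map (posSemidef_ketbra x)).1.eq]

/-- Measure the effect `A` and prepare `P`. -/
def measurePrepare {k : Type*} (A : Matrix n n ℂ) (P : Matrix k k ℂ) : Matrix n n ℂ →ₗ[ℂ] Matrix k k ℂ :=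
  ((traceLinearMap n ℂ ℂ) ∘ₗ (LinearMap.mulLeft ℂ A)).smulRight P

lemma measurePrepare_apply {k : Type*} (A : Matrix n n ℂ) (P : Matrix k k ℂ) (Y : Matrix n n ℂ) :
    measurePrepare A P Y = (A * Y).trace • P := rfl

lemma posSemidef_ampliation_measurePrepare [DecidableEq n] [DecidableEq k] {A : Matrix n n ℂ}
    {P : Matrix k k ℂ} (hA : A.PosSemidef) (hP : P.PosSemidef) (r : ℕ)
    {X : Matrix (Fin r × n) (Fin r × n) ℂ} (hX : X.PosSemidef) :
    (ampliation r (measurePrepare A P) X).PosSemidef := by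
  obtain ⟨C, rfl⟩ : ∃ C : Matrix n n ℂ, A = Cᴴ * C := by
    open scoped MatrixOrder in
    exact CStarAlgebra.nonneg_iff_eq_star_mul_self.1 hA.nonneg
  let K : n → Matrix (Fin r) (Fin r × n) ℂ := fun s =>
    Matrix.of fun p q => if p = q.1 then C s q.2 else 0
  have hM : (∑ s, K s * X * (K s)ᴴ).PosSemidef :=
    posSemidef_sum _ fun s _ => hX.mul_mul_conjTranspose_same (K s)
  have hK : ∀ s p q, (K s * X * (K s)ᴴ) p q
      = (C * (Matrix.of fun i j => X (p, i) (q, j)) * Cᴴ) s s := fun s p q => by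
    simp [K, mul_apply, Fintype.sum_prod_type, Finset.sum_mul, apply_ite (starRingEnd ℂ)]
  have heq : ampliation r (measurePrepare (Cᴴ * C) P) X
      = kroneckerMap (· * ·) (∑ s, K s * X * (K s)ᴴ) P := by
    ext ⟨p, i⟩ ⟨q, j⟩
    simp only [ampliation, measurePrepare_apply, of_apply, Matrix.smul_apply, smul_eq_mul,
      kroneckerMap_apply]
    congr 1
    rw [Matrix.sum_apply, mul_assoc, trace_mul_comm]
    exact Finset.sum_congr rfl fun s _ => (hK s p q).symm
  rw [heq]
  exact hM.kronecker hP

lemma isCPTP_measurePrepare_add [DecidableEq n] [DecidableEq k] {A : Matrix n n ℂ}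
    {P T : Matrix k k ℂ} (hA : A.PosSemidef) (hA1 : (1 - A).PosSemidef) (hP : P.PosSemidef)
    (hT : T.PosSemidef) (hPt : P.trace = 1) (hTt : T.trace = 1) :
    IsCPTP (measurePrepare A P + measurePrepare (1 - A) T) where
  completelyPositive r X hX := by
    have h := (posSemidef_ampliation_measurePrepare hA hP r hX).add
      (posSemidef_ampliation_measurePrepare hA1 hT r hX)
    exact h
  tracePreserving X := by
    simp only [LinearMap.add_apply, measurePrepare_apply, trace_add, trace_smul, hPt, hTt, sub_mul,
      one_mul, trace_sub, smul_eq_mul, mul_one]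
    ring

end Operations

section Isotropic

variable {a b κ : Type*} [Fintype a] [Fintype b] [Fintype κ] [DecidableEq κ]

lemma posSemidef_of_mem_SEP {σ : Matrix (a × b) (a × b) ℂ} (hσ : σ ∈ SEP a b) :
    σ.PosSemidef := by
  have hconv : Convex ℝ {X : Matrix (a × b) (a × b) ℂ | X.PosSemidef} := by
    intro X hX Z hZ s t hs ht _
    exact (PosSemidef.smul hX hs).add (PosSemidef.smul hZ ht)
  refine convexHull_min ?_ hconv hσ
  rintro X ⟨φ, η, hφ, hη, rfl⟩
  exact posSemidef_ketbra _

/-- Orthogonality of the characters of `(ℤ/3)^κ` with exponent `e_i - e_j - e_k + e_l`. -/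
lemma sum_stdAddChar_pair (i j k l : κ) :
    ∑ θ : κ → ZMod 3, ZMod.stdAddChar (θ i - θ j - θ k + θ l)
      = if (i = j ∧ k = l) ∨ (i = k ∧ j = l) then (Fintype.card (κ → ZMod 3) : ℂ) else 0 := by
  classical
  let h : (κ → ZMod 3) →+ ZMod 3 :=
    Pi.evalAddMonoidHom (fun _ => ZMod 3) i - Pi.evalAddMonoidHom (fun _ => ZMod 3) j
      - Pi.evalAddMonoidHom (fun _ => ZMod 3) k + Pi.evalAddMonoidHom (fun _ => ZMod 3) l
  let χ : AddChar (κ → ZMod 3) ℂ := (ZMod.stdAddChar (N := 3)).compAddMonoidHom h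
  have hχ : ∀ θ, χ θ = ZMod.stdAddChar (θ i - θ j - θ k + θ l) := fun θ => rfl
  simp only [← hχ]
  rw [AddChar.sum_eq_ite]
  congr 1
  refine propext ⟨fun h0 => ?_, fun h0 => ?_⟩
  · have hz : ∀ θ : κ → ZMod 3, θ i - θ j - θ k + θ l = 0 := fun θ => by
      have h1 : χ θ = 1 := by rw [h0]; rfl
      rw [hχ, ← AddChar.map_zero_eq_one (ZMod.stdAddChar (N := 3))] at h1
      exact ZMod.injective_stdAddChar h1
    by_cases hij : i = j
    · subst hij
      refine Or.inl ⟨rfl, ?_⟩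
      have := hz (Pi.single k 1)
      by_contra hkl
      simp [Pi.single_apply, Ne.symm hkl] at this
    · by_cases hik : i = k
      · subst hik
        refine Or.inr ⟨rfl, ?_⟩
        have := hz (Pi.single j 1)
        by_contra hjl
        simp [Ne.symm hjl, hij] at this
      · exfalso
        have := hz (Pi.single i 1)
        by_cases hil : l = i
        · simp [hil, Ne.symm hij, Ne.symm hik] at this
          revert this
          decide
        · simp [hil, Ne.symm hij, Ne.symm hik] at this
  · ext θ
    rw [hχ]
    rcases h0 with ⟨rfl, rfl⟩ | ⟨rfl, rfl⟩ <;> simp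

/-- The maximally mixed state off the diagonal. -/
def offDiagState (m : ℕ) : Matrix (Fin m × Fin m) (Fin m × Fin m) ℂ :=
  Matrix.diagonal fun p => if p.1 = p.2 then 0 else ((1 / ((m : ℝ) * (m - 1)) : ℝ) : ℂ)

lemma offDiagState_mem_SEP {m : ℕ} (hm : 2 ≤ m) : offDiagState m ∈ SEP (Fin m) (Fin m) := by
  have hm' : (2 : ℝ) ≤ m := by exact_mod_cast hm
  have h := (convex_SEP (a := Fin m) (b := Fin m)).sum_mem (t := Finset.univ)
    (w := fun p : Fin m × Fin m => if p.1 = p.2 then 0 else (1 / ((m : ℝ) * (m - 1)) : ℝ))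
    (z := fun p => ketbra (prodVec (EuclideanSpace.single p.1 1) (EuclideanSpace.single p.2 1)))
    (fun p _ => by
      split_ifs
      · exact le_rfl
      · have : (0 : ℝ) ≤ m - 1 := by linarith
        positivity)
    (by
      have hne : (m : ℝ) - 1 ≠ 0 := by linarith
      have hne' : (m : ℝ) ≠ 0 := by linarith
      rw [Fintype.sum_prod_type]
      simp only [Finset.sum_ite, Finset.sum_const_zero, zero_add, Finset.sum_const, nsmul_eq_mul]
      have hc : ∀ i : Fin m, ((Finset.univ.filter fun j => ¬ i = j).card : ℝ) = m - 1 := fun i => by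
        rw [Finset.filter_not, Finset.filter_eq Finset.univ i, if_pos (Finset.mem_univ i),
          Finset.card_sdiff_of_subset (Finset.subset_univ _)]
        simp [Nat.cast_sub (by omega : 1 ≤ m)]
      simp only [hc, Finset.sum_const, Finset.card_univ, Fintype.card_fin, nsmul_eq_mul]
      field_simp)
    (fun p _ => ketbra_prodVec_mem_SEP (by simp) (by simp))
  convert h using 1
  ext p q
  rw [Matrix.sum_apply, Finset.sum_eq_single p]
  · by_cases hpq : p = q
    · subst hpq
      by_cases h : p.1 = p.2 <;> simp [offDiagState, ketbra, prodVec, h]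
    · have : ¬ (q.1 = p.1 ∧ q.2 = p.2) := fun h => hpq (Prod.ext h.1.symm h.2.symm)
      rw [offDiagState, diagonal_apply_ne _ hpq]
      simp only [ketbra, prodVec, Matrix.smul_apply, of_apply, PiLp.single_apply]
      split_ifs <;> simp_all
  · intro r _ hr
    have : ¬ (p.1 = r.1 ∧ p.2 = r.2) := fun h => hr (Prod.ext h.1.symm h.2.symm)
    simp only [ketbra, prodVec, Matrix.smul_apply, of_apply, PiLp.single_apply]
    split_ifs <;> simp_all
  · simp

/-- The isotropic-type state at the separability threshold is an average of product states with
conjugate phases. -/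
lemma threshold_mem_SEP {m : ℕ} (hm : 2 ≤ m) :
    (1 / (m : ℝ)) • ketbra (maxEntangled m) + (1 - 1 / (m : ℝ)) • offDiagState m
      ∈ SEP (Fin m) (Fin m) := by
  have hm' : (2 : ℝ) ≤ m := by exact_mod_cast hm
  have hsq : Real.sqrt m ^ 2 = m := Real.sq_sqrt (by linarith)
  let N : ℝ := Fintype.card (Fin m → ZMod 3)
  have hN : N ≠ 0 := by simp [N]
  have hnorm : ∀ θ : Fin m → ZMod 3, ‖(WithLp.toLp 2 fun i =>
      ((1 / Real.sqrt m : ℝ) : ℂ) * ZMod.stdAddChar (θ i) : EuclideanSpace ℂ (Fin m))‖ = 1 := by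
    intro θ
    rw [← sq_eq_sq₀ (norm_nonneg _) zero_le_one, EuclideanSpace.norm_sq_eq]
    have hne : (m : ℝ) ≠ 0 := by linarith
    simp [hsq, AddChar.norm_apply, hne]
  have h := (convex_SEP (a := Fin m) (b := Fin m)).sum_mem (t := Finset.univ)
    (w := fun _ : Fin m → ZMod 3 => 1 / N)
    (z := fun θ => ketbra (prodVec
      (WithLp.toLp 2 fun i => ((1 / Real.sqrt m : ℝ) : ℂ) * ZMod.stdAddChar (θ i))
      (WithLp.toLp 2 fun i => ((1 / Real.sqrt m : ℝ) : ℂ) * ZMod.stdAddChar ((-θ) i))))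
    (fun θ _ => by positivity)
    (by
      rw [Finset.sum_const, Finset.card_univ, nsmul_eq_mul]
      exact mul_one_div_cancel hN)
    (fun θ _ => ketbra_prodVec_mem_SEP (hnorm θ) (hnorm (-θ)))
  convert h using 1
  ext ⟨i, j⟩ ⟨k, l⟩
  have hterm : ∀ θ : Fin m → ZMod 3, ((1 / N) • ketbra (prodVec
      (WithLp.toLp 2 fun i => ((1 / Real.sqrt m : ℝ) : ℂ) * ZMod.stdAddChar (θ i))
      (WithLp.toLp 2 fun i => ((1 / Real.sqrt m : ℝ) : ℂ) * ZMod.stdAddChar ((-θ) i))))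
        (i, j) (k, l)
      = ((1 / N * (1 / m ^ 2) : ℝ) : ℂ) * ZMod.stdAddChar (θ i - θ j - θ k + θ l) := by
    intro θ
    have h4 : ((1 / Real.sqrt m : ℝ) : ℂ) ^ 4 = ((1 / m ^ 2 : ℝ) : ℂ) := by
      rw [← Complex.ofReal_pow]
      congr 1
      rw [div_pow, show Real.sqrt m ^ 4 = (Real.sqrt m ^ 2) ^ 2 by ring, hsq, one_pow]
    have hexp : ZMod.stdAddChar (θ i - θ j - θ k + θ l) = ZMod.stdAddChar (θ i)
        * ZMod.stdAddChar (-θ j) * (ZMod.stdAddChar (-θ k) * ZMod.stdAddChar (θ l)) := by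
      simp only [← AddChar.map_add_eq_mul]
      congr 1
      ring
    rw [hexp, Complex.ofReal_mul, ← h4]
    simp only [ketbra, prodVec, Matrix.smul_apply, of_apply, Pi.neg_apply, star_mul',
      Complex.real_smul, Complex.star_def, ← AddChar.map_neg_eq_conj, neg_neg, Complex.conj_ofReal]
    ring
  rw [Matrix.sum_apply, Finset.sum_congr rfl fun θ _ => hterm θ, ← Finset.mul_sum,
    sum_stdAddChar_pair]
  have hNc : (Fintype.card (Fin m → ZMod 3) : ℂ) = (N : ℂ) := by simp [N]
  rw [hNc]
  have hs2 : ((1 / Real.sqrt m : ℝ) : ℂ) * ((1 / Real.sqrt m : ℝ) : ℂ) = ((1 / m : ℝ) : ℂ) := by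
    norm_cast
    rw [← sq, div_pow, hsq, one_pow]
  have hmain : ∀ P : Prop, [Decidable P] → (((1 / N * (1 / m ^ 2) : ℝ) : ℂ) *
      if P then (N : ℂ) else 0) = if P then ((1 / m ^ 2 : ℝ) : ℂ) else 0 := by
    intro P _
    split_ifs
    · norm_cast
      field_simp
    · simp
  rw [hmain]
  have hm0 : (m : ℝ) ≠ 0 := by linarith
  have hm1 : (m : ℝ) - 1 ≠ 0 := by linarith
  have hd : (1 / (m : ℝ)) * (1 / m) = 1 / m ^ 2 := by field_simp
  have ho : (1 - 1 / (m : ℝ)) * (1 / (m * (m - 1))) = 1 / m ^ 2 := by field_simp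
  simp only [Matrix.add_apply, Matrix.smul_apply, Complex.real_smul, ketbra, of_apply, maxEntangled,
    offDiagState, diagonal_apply, Prod.mk.injEq, Complex.star_def, apply_ite (starRingEnd ℂ),
    Complex.conj_ofReal, map_zero]
  by_cases hij : i = j
  · by_cases hkl : k = l
    · simp only [hij, hkl, and_self, true_or, if_pos, hs2]
      rw [← Complex.ofReal_mul, hd]
      simp
    · have hn : ¬ (j = k ∧ j = l) := fun h => hkl (h.1.symm.trans h.2)
      simp [hij, hkl, hn]
  · by_cases hik : i = k ∧ j = l
    · rw [if_neg hij, if_pos hik, if_neg hij, if_pos (Or.inr hik), zero_mul, mul_zero, zero_add,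
        ← Complex.ofReal_mul, ho]
    · simp [hij, hik]

end Isotropic

section Fidelity

variable {a b ι : Type*} [Fintype a] [Fintype b] [Fintype ι] [DecidableEq a] [DecidableEq b]

lemma maxEntangled_eq_sum (m : ℕ) : maxEntangled m =
    ∑ i : Fin m, ((1 / Real.sqrt m : ℝ) : ℂ) •
      prodVec (EuclideanSpace.single i 1) (EuclideanSpace.single i 1) := by
  ext ⟨i, j⟩
  simp [maxEntangled, prodVec, eq_comm]

lemma norm_maxEntangled {m : ℕ} (hm : 1 ≤ m) : ‖maxEntangled m‖ = 1 := by
  have ho := EuclideanSpace.orthonormal_single (𝕜 := ℂ) (ι := Fin m)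
  have hm' : (m : ℝ) ≠ 0 := by positivity
  rw [← sq_eq_sq₀ (norm_nonneg _) zero_le_one, maxEntangled_eq_sum,
    norm_sq_sum_smul_of_orthonormal (orthonormal_prodVec ho ho)]
  simp [hm']

lemma hsInner_maxEntangled_le_of_mem_SEP {m : ℕ}
    {σ : Matrix (Fin m × Fin m) (Fin m × Fin m) ℂ} (hσ : σ ∈ SEP (Fin m) (Fin m)) :
    hsInner σ (ketbra (maxEntangled m)) ≤ 1 / m := by
  have ho := EuclideanSpace.orthonormal_single (𝕜 := ℂ) (ι := Fin m)
  rw [hsInner_comm]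
  refine hsInner_le_of_mem_SEP (fun φ η hφ hη => ?_) hσ
  rw [hsInner_ketbra_ketbra, maxEntangled_eq_sum]
  have h := norm_inner_prodVec_schmidt_le ho ho (w := fun _ => ((1 / Real.sqrt m : ℝ) : ℂ))
    (c := 1 / Real.sqrt m) (by positivity)
    (fun i => by rw [Complex.norm_real, Real.norm_of_nonneg (by positivity)]) hφ hη
  refine (pow_le_pow_left₀ (norm_nonneg _) h 2).trans (le_of_eq ?_)
  rw [div_pow, Real.sq_sqrt (by positivity), one_pow]

lemma fidelity_le_of_mem_SEPP {e : ι → EuclideanSpace ℂ a} {f : ι → EuclideanSpace ℂ b}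
    (he : Orthonormal ℂ e) (hf : Orthonormal ℂ f) (ξ : EuclideanSpace ℂ ι) {m : ℕ} (hm : 1 ≤ m)
    {Λ : Matrix (a × b) (a × b) ℂ →ₗ[ℂ] Matrix (Fin m × Fin m) (Fin m × Fin m) ℂ}
    (hΛ : Λ ∈ SEPP a b (Fin m) (Fin m)) :
    hsInner (Λ (ketbra (∑ i, ξ i • prodVec (e i) (f i)))) (ketbra (maxEntangled m))
      ≤ (1 / (m : ℝ)) * distNorm m ξ ^ 2 := by
  have hm' : (0 : ℝ) < m := by exact_mod_cast hm
  obtain ⟨X, hX, hX1, hXΛ⟩ := hΛ.1.exists_effect (norm_maxEntangled hm)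
  have h := hsInner_ketbra_le_distNorm_sq he hf ξ hm'.le (X := (m : ℝ) • X)
    (PosSemidef.smul hX hm'.le)
    (by rw [← smul_sub]; exact PosSemidef.smul hX1 hm'.le)
    fun φ η hφ hη => by
      rw [hsInner_smul_right, hXΛ]
      have := hsInner_maxEntangled_le_of_mem_SEP (hΛ.2 _ (ketbra_prodVec_mem_SEP hφ hη))
      rwa [le_div_iff₀' hm'] at this
  rw [hsInner_smul_right, hXΛ] at h
  rw [one_div, ← div_eq_inv_mul, le_div_iff₀' hm']
  exact h

lemma trace_mul_eq_hsInner {n : Type*} [Fintype n] [DecidableEq n] {A Y : Matrix n n ℂ}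
    (hA : A.PosSemidef) (hY : Y.PosSemidef) : (A * Y).trace = (hsInner A Y : ℂ) := by
  have h := Complex.nonneg_iff.1 (trace_mul_nonneg_of_posSemidef hA hY)
  rw [hsInner, hA.1.eq]
  exact Complex.ext rfl h.2.symm

lemma hsInner_nonneg {n : Type*} [Fintype n] [DecidableEq n] {A Y : Matrix n n ℂ}
    (hA : A.PosSemidef) (hY : Y.PosSemidef) : 0 ≤ hsInner A Y := by
  rw [hsInner, hA.1.eq]
  exact (Complex.nonneg_iff.1 (trace_mul_nonneg_of_posSemidef hA hY)).1

lemma measurePrepare_add_apply {n k : Type*} [Fintype n] [DecidableEq n]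
    {A Y : Matrix n n ℂ} (hA : A.PosSemidef) (hY : Y.PosSemidef) (hY1 : Y.trace = 1)
    (P T : Matrix k k ℂ) :
    (measurePrepare A P + measurePrepare (1 - A) T : Matrix n n ℂ →ₗ[ℂ] Matrix k k ℂ) Y
      = hsInner A Y • P + (1 - hsInner A Y) • T := by
  ext i j
  simp [measurePrepare_apply, sub_mul, trace_mul_eq_hsInner hA hY, hY1]

lemma hsInner_maxEntangled_offDiagState (m : ℕ) :
    hsInner (ketbra (maxEntangled m)) (offDiagState m) = 0 := by
  rw [hsInner_ketbra_left, dotProduct, Finset.sum_eq_zero, Complex.zero_re]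
  intro p _
  by_cases h : p.1 = p.2 <;> simp [offDiagState, mulVec_diagonal, maxEntangled, h]

/-- The operation that measures a rank-one effect and prepares the maximally entangled state or the
off-diagonal state. -/
lemma measurePrepare_mem_SEPP {m : ℕ} (hm : 2 ≤ m) {v : EuclideanSpace ℂ (a × b)}
    (hvm : ‖v‖ ^ 2 ≤ m)
    (hvp : ∀ (φ : EuclideanSpace ℂ a) (η : EuclideanSpace ℂ b), ‖φ‖ = 1 → ‖η‖ = 1 →
      hsInner (ketbra (prodVec φ η)) (ketbra v) ≤ 1) :
    measurePrepare ((1 / (m : ℝ)) • ketbra v) (ketbra (maxEntangled m))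
      + measurePrepare (1 - (1 / (m : ℝ)) • ketbra v) (offDiagState m)
        ∈ SEPP a b (Fin m) (Fin m) := by
  have hm' : (0 : ℝ) < m := by positivity
  have hA : ((1 / (m : ℝ)) • ketbra v).PosSemidef :=
    PosSemidef.smul (posSemidef_ketbra v) (by positivity)
  have hA1 : (1 - (1 / (m : ℝ)) • ketbra v).PosSemidef := by
    have h := PosSemidef.smul (posSemidef_smul_one_sub_ketbra hvm)
      (show (0 : ℝ) ≤ 1 / m by positivity)
    rwa [smul_sub, smul_smul, one_div_mul_cancel hm'.ne', one_smul] at h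
  have hT := offDiagState_mem_SEP hm
  refine ⟨isCPTP_measurePrepare_add hA hA1 (posSemidef_ketbra _) (posSemidef_of_mem_SEP hT)
    (by simp [trace_ketbra, norm_maxEntangled (by omega : 1 ≤ m)]) (trace_of_mem_SEP hT),
    fun σ hσ => ?_⟩
  have hσp := posSemidef_of_mem_SEP hσ
  rw [measurePrepare_add_apply hA hσp (trace_of_mem_SEP hσ)]
  have h0 := hsInner_nonneg (posSemidef_ketbra v) hσp
  have h1 := hsInner_le_of_mem_SEP hvp hσ
  have hp : hsInner ((1 / (m : ℝ)) • ketbra v) σ = 1 / m * hsInner (ketbra v) σ := by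
    rw [hsInner_comm, hsInner_smul_right, hsInner_comm]
  rw [hp]
  have h := convex_SEP (threshold_mem_SEP hm) hT h0 (sub_nonneg.2 h1) (by ring)
  convert h using 1
  rw [smul_add, smul_smul, smul_smul, add_assoc, ← add_smul]
  congr 2 <;> ring

lemma isGreatest_fidelityValues {e : ι → EuclideanSpace ℂ a} {f : ι → EuclideanSpace ℂ b}
    (he : Orthonormal ℂ e) (hf : Orthonormal ℂ f) {ξ : ι → ℝ} (hξ : ∀ i, 0 ≤ ξ i)
    {ψ : EuclideanSpace ℂ (a × b)} (hψ : ‖ψ‖ = 1)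
    (hsch : ψ = ∑ i, (ξ i : ℂ) • prodVec (e i) (f i)) {m : ℕ} (hm : 1 ≤ m) :
    IsGreatest (fidelityValues (SEPP a b (Fin m) (Fin m)) (ketbra ψ))
      ((1 / (m : ℝ)) * distNorm m (toComplexVec ξ) ^ 2) := by
  have hsum : ∑ i, ξ i ^ 2 = 1 := by
    have h := norm_sq_sum_smul_of_orthonormal (orthonormal_prodVec he hf) fun i => (ξ i : ℂ)
    rw [← hsch, hψ] at h
    simpa using h.symm
  have hub : ∀ Λ ∈ SEPP a b (Fin m) (Fin m),
      hsInner (Λ (ketbra ψ)) (ketbra (maxEntangled m))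
        ≤ (1 / (m : ℝ)) * distNorm m (toComplexVec ξ) ^ 2 := fun Λ hΛ => by
    rw [hsch]
    exact fidelity_le_of_mem_SEPP he hf (toComplexVec ξ) hm hΛ
  have hψt : (ketbra ψ).trace = 1 := by simp [trace_ketbra, hψ]
  have hΨ : hsInner (ketbra (maxEntangled m)) (ketbra (maxEntangled m)) = 1 := by
    rw [hsInner_ketbra_ketbra, inner_self_eq_norm_sq_to_K, norm_maxEntangled hm]
    simp
  refine ⟨?_, by rintro r ⟨Λ, hΛ, rfl⟩; exact hub Λ hΛ⟩
  obtain rfl | hm2 : m = 1 ∨ 2 ≤ m := by omega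
  · have hsep : ketbra (maxEntangled 1) ∈ SEP (Fin 1) (Fin 1) := by
      rw [maxEntangled_eq_sum]
      simpa using ketbra_prodVec_mem_SEP (a := Fin 1) (b := Fin 1)
        (φ := EuclideanSpace.single 0 1) (η := EuclideanSpace.single 0 1) (by simp) (by simp)
    have hmem : measurePrepare (1 : Matrix (a × b) (a × b) ℂ) (ketbra (maxEntangled 1))
        + measurePrepare (1 - 1) (ketbra (maxEntangled 1)) ∈ SEPP a b (Fin 1) (Fin 1) := by
      refine ⟨isCPTP_measurePrepare_add PosSemidef.one (by simpa using PosSemidef.zero)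
        (posSemidef_ketbra _) (posSemidef_ketbra _) (trace_of_mem_SEP hsep)
        (trace_of_mem_SEP hsep), fun σ hσ => ?_⟩
      rw [measurePrepare_add_apply PosSemidef.one (posSemidef_of_mem_SEP hσ) (trace_of_mem_SEP hσ),
        ← add_smul]
      simpa using hsep
    refine ⟨_, hmem, le_antisymm ?_ (hub _ hmem)⟩
    rw [measurePrepare_add_apply PosSemidef.one (posSemidef_ketbra ψ) hψt, ← add_smul,
      add_sub_cancel, one_smul, hΨ]
    have hn : ‖toComplexVec ξ‖ = 1 := by
      rw [← sq_eq_sq₀ (norm_nonneg _) zero_le_one, EuclideanSpace.norm_sq_eq]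
      simpa [toComplexVec] using hsum
    have hd := distNorm_le_of_eq_add (m := (1 : ℕ)) (x := toComplexVec ξ) (y := 0)
      (z := toComplexVec ξ) (by simp)
    simp only [PiLp.zero_apply, norm_zero, Finset.sum_const_zero, zero_add, Nat.cast_one,
      Real.sqrt_one, one_mul, hn] at hd
    have := (sq_le_one_iff₀ (distNorm_nonneg 1 (toComplexVec ξ))).2 hd
    simpa using this
  · obtain ⟨v, hvm, hvp, hv⟩ := exists_optimal_vector he hf hξ hsum
      (show (1 : ℝ) ≤ m by exact_mod_cast hm)
    rw [← hsch] at hv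
    have hmem := measurePrepare_mem_SEPP hm2 hvm hvp
    refine ⟨_, hmem, le_antisymm ?_ (hub _ hmem)⟩
    rw [measurePrepare_add_apply (PosSemidef.smul (posSemidef_ketbra v) (by positivity))
      (posSemidef_ketbra ψ) hψt, hsInner_comm, hsInner_add_right, hsInner_smul_right,
      hsInner_smul_right, hΨ, hsInner_maxEntangled_offDiagState, mul_zero, add_zero, mul_one,
      hsInner_comm, hsInner_smul_right]
    gcongr

end Fidelity

section Schmidt

lemma exists_orthonormal_of_pairwise_orthogonal {p q : ℕ} (hpq : p ≤ q)
    (g : Fin p → EuclideanSpace ℂ (Fin q)) (hg : ∀ i j, i ≠ j → ⟪g i, g j⟫_ℂ = 0) :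
    ∃ f : Fin p → EuclideanSpace ℂ (Fin q), Orthonormal ℂ f ∧ ∀ i, g i = (‖g i‖ : ℂ) • f i := by
  let v : Fin q → EuclideanSpace ℂ (Fin q) := fun j =>
    if h : (j : ℕ) < p then ((‖g ⟨j, h⟩‖⁻¹ : ℝ) : ℂ) • g ⟨j, h⟩ else 0
  let s : Set (Fin q) := {j | ∃ h : (j : ℕ) < p, g ⟨j, h⟩ ≠ 0}
  have hv : Orthonormal ℂ (s.domRestrict v) := by
    constructor
    · rintro ⟨j, h, hj⟩
      simp [v, h, norm_smul, norm_ne_zero_iff.2 hj]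
    · rintro ⟨j, h, hj⟩ ⟨k, h', hk⟩ hjk
      have : (⟨j, h⟩ : Fin p) ≠ ⟨k, h'⟩ := fun hh => hjk (by
        ext; simpa using hh)
      simp [v, h, h', inner_smul_left, inner_smul_right, hg _ _ this]
  obtain ⟨B, hB⟩ := hv.exists_orthonormalBasis_extension_of_card_eq (by simp)
  refine ⟨fun i => B (Fin.castLE hpq i), B.orthonormal.comp _ (Fin.castLE_injective hpq),
    fun i => ?_⟩
  by_cases hi : g i = 0
  · simp [hi]
  · have hm : Fin.castLE hpq i ∈ s := ⟨i.2, hi⟩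
    have hn : (‖g i‖ : ℂ) ≠ 0 := by simpa using hi
    dsimp only
    rw [hB _ hm]
    simp [v, smul_smul, hn]

lemma exists_schmidt_of_le {p q : ℕ} (hpq : p ≤ q) (ψ : EuclideanSpace ℂ (Fin p × Fin q)) :
    ∃ (ξ : Fin p → ℝ) (e : Fin p → EuclideanSpace ℂ (Fin p))
      (f : Fin p → EuclideanSpace ℂ (Fin q)), (∀ i, 0 ≤ ξ i) ∧ Orthonormal ℂ e ∧
        Orthonormal ℂ f ∧ ψ = ∑ i, (ξ i : ℂ) • prodVec (e i) (f i) := by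
  let M : Matrix (Fin p) (Fin q) ℂ := Matrix.of fun i j => ψ (i, j)
  have hH : (M * Mᴴ).IsHermitian := isHermitian_mul_conjTranspose_self M
  let e := hH.eigenvectorBasis
  let g : Fin p → EuclideanSpace ℂ (Fin q) := fun i => WithLp.toLp 2 (star (e i).ofLp ᵥ* M)
  have hg : ∀ i j, i ≠ j → ⟪g i, g j⟫_ℂ = 0 := fun i j hij => by
    rw [EuclideanSpace.inner_eq_star_dotProduct]
    simp only [g]
    rw [star_vecMul, star_star, ← dotProduct_mulVec, mulVec_mulVec,
      hH.mulVec_eigenvectorBasis i, dotProduct_smul, dotProduct_comm,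
      ← EuclideanSpace.inner_eq_star_dotProduct]
    rw [e.orthonormal.2 hij.symm, smul_zero]
  obtain ⟨f, hf, hgf⟩ := exists_orthonormal_of_pairwise_orthogonal hpq g hg
  refine ⟨fun i => ‖g i‖, e, f, fun i => norm_nonneg _, e.orthonormal, hf, ?_⟩
  ext ⟨x, y⟩
  have h1 := congrArg (fun u : EuclideanSpace ℂ (Fin p) => u x)
    (e.sum_repr' (WithLp.toLp 2 fun i => ψ (i, y)))
  have h2 : ∀ i, ⟪e i, WithLp.toLp 2 fun i => ψ (i, y)⟫_ℂ = (‖g i‖ : ℂ) * f i y := fun i => by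
    have h3 : g i y = (‖g i‖ : ℂ) * f i y := by
      conv_lhs => rw [hgf i]
      rfl
    rw [← h3, EuclideanSpace.inner_eq_star_dotProduct, dotProduct_comm]
    rfl
  simp only [h2, WithLp.ofLp_sum, Finset.sum_apply, PiLp.smul_apply, smul_eq_mul] at h1
  simp only [prodVec, WithLp.ofLp_sum, Finset.sum_apply, PiLp.smul_apply, smul_eq_mul]
  rw [← h1]
  exact Finset.sum_congr rfl fun i _ => by ring

lemma exists_isSchmidtVector {dA dB : ℕ} (ψ : EuclideanSpace ℂ (Fin dA × Fin dB)) :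
    ∃ ξ : Fin (min dA dB) → ℝ, IsSchmidtVector ψ ξ := by
  unfold IsSchmidtVector
  rcases le_total dA dB with h | h
  · rw [min_eq_left h]
    obtain ⟨ξ, e, f, hξ, he, hf, hψ⟩ := exists_schmidt_of_le h ψ
    exact ⟨ξ, hξ, e, f, he, hf, hψ⟩
  · rw [min_eq_right h]
    obtain ⟨ξ, e, f, hξ, he, hf, hψ⟩ :=
      exists_schmidt_of_le h (WithLp.toLp 2 fun p => ψ (p.2, p.1))
    refine ⟨ξ, hξ, f, e, hf, he, ?_⟩
    ext ⟨x, y⟩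
    have h1 := congrArg (fun u : EuclideanSpace ℂ (Fin dB × Fin dA) => u (y, x)) hψ
    simp only [prodVec, WithLp.ofLp_sum, Finset.sum_apply, PiLp.smul_apply, smul_eq_mul] at h1 ⊢
    rw [h1]
    exact Finset.sum_congr rfl fun i _ => by ring

end Schmidt

end Distill

end

theorem mainTheorem2 (dA dB : ℕ) (ψ : EuclideanSpace ℂ (Fin dA × Fin dB)) (hψ : ‖ψ‖ = 1) :
    (∃ ξ : Fin (min dA dB) → ℝ, Distill.IsSchmidtVector ψ ξ) ∧
    ∀ ξ : Fin (min dA dB) → ℝ, Distill.IsSchmidtVector ψ ξ →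
      (∀ m : ℝ, 1 ≤ m →
        -- the monotone is a maximum
        IsGreatest (Distill.monotoneValues (Distill.SEP (Fin dA) (Fin dB)) (m - 1)
            (Distill.ketbra ψ))
          (Distill.monotone (Distill.SEP (Fin dA) (Fin dB)) (m - 1) (Distill.ketbra ψ)) ∧
        Distill.monotone (Distill.SEP (Fin dA) (Fin dB)) (m - 1) (Distill.ketbra ψ) =
          Distill.distNorm m (Distill.toComplexVec ξ) ^ 2 - 1) ∧
      (∀ m : ℕ, 1 ≤ m →
        -- the fidelity is a supremum
        IsLUB (Distill.fidelityValues (Distill.SEPP (Fin dA) (Fin dB) (Fin m) (Fin m))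
            (Distill.ketbra ψ))
          (Distill.fidelitySEPP (Distill.ketbra ψ) m) ∧
        Distill.fidelitySEPP (Distill.ketbra ψ) m =
          (1 / (m : ℝ)) * Distill.distNorm (m : ℝ) (Distill.toComplexVec ξ) ^ 2) := by
  refine ⟨Distill.exists_isSchmidtVector ψ, ?_⟩
  rintro ξ ⟨hξ, e, f, he, hf, hsch⟩
  refine ⟨fun m hm => ?_, fun m hm => ?_⟩
  · have h := Distill.isGreatest_monotoneValues he hf hξ hψ hsch hm
    have heq : Distill.monotone (Distill.SEP (Fin dA) (Fin dB)) (m - 1) (Distill.ketbra ψ) =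
        Distill.distNorm m (Distill.toComplexVec ξ) ^ 2 - 1 := h.csSup_eq
    exact ⟨heq ▸ h, heq⟩
  · have h := Distill.isGreatest_fidelityValues he hf hξ hψ hsch hm
    have heq : Distill.fidelitySEPP (Distill.ketbra ψ) m =
        (1 / (m : ℝ)) * Distill.distNorm (m : ℝ) (Distill.toComplexVec ξ) ^ 2 := h.csSup_eq
    exact ⟨heq ▸ h.isLUB, heq⟩
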